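/- Let $I\subseteq\mathbb{R}$ be a nonempty open interval, let $(F,g_F)$ be a connected smooth Riemannian manifold of dimension $m\ge 2$, and let $f\colon I\to(0,\infty)$ be smooth. Let $\overline{M}=I\times_f F$ be the generalized Robertson–Walker (GRW) spacetime with these data, that is, the manifold $I\times F$ with the Lorentzian metric $$\overline{g}=-\pi_I^*(dt^2)+f(\pi_I)^2\,\pi_F^*(g_F),$$ time-oriented by $\partial_t$. It is called non-contracting if $f'\ge 0$ on $I$ and non-expanding if $f'\le 0$ on $I$. Let $\psi\colon M^k\to\overline{M}$, $k\ge 1$, be a smooth immersion of a connected smooth manifold which is spacelike (the induced tensor $g=\psi^*\overline{g}$ is Riemannian). Its second fundamental form and mean curvature vector are $$\mathrm{II}(X,Y)=-\bigl(\overline{\nabla}_XY\bigr)^{\perp},\qquad \overrightarrow{H}=\tfrac1k\,\mathrm{trace}_g(\mathrm{II}),$$ where $\overline{\nabla}$ is the Levi-Civita connection of $\overline{g}$ and $\perp$ denotes the component normal to the submanifold (note the sign convention). The submanifold is weakly future (resp. past) trapped if, at every point of $M$, $\overrightarrow{H}$ is causal (i.e. $\overrightarrow{H}\neq 0$ and $\overline{g}(\overrightarrow{H},\overrightarrow{H})\le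 0$) and future pointing, $\overline{g}(\overrightarrow{H},\partial_t)<0$ (resp. past pointing, $\overline{g}(\overrightarrow{H},\partial_t)>0$). It is closed if $M$ is compact without boundary. Then: (i) If $\overline{M}$ is non-contracting, there are no closed weakly future trapped submanifolds in $\overline{M}$ (of any dimension $k\ge 1$). (ii) If $\overline{M}$ is non-expanding, there are no closed weakly past trapped submanifolds in $\overline{M}$ (of any dimension $k\ge 1$). -/

import Mathlib

open Set Manifold
open scoped ContDiff

noncomputable section

/-! ### Metric tensors and the Levi-Civita connection in charts -/

section Metric

variable {E H N : Type*} [NormedAddCommGroup E] [NormedSpace ℝ E] [TopologicalSpace H]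
  [TopologicalSpace N] [ChartedSpace H N] (I : ModelWithCorners ℝ E H)

/-- A field of bilinear forms on the tangent spaces of the manifold `N`
(no signature and no smoothness are imposed in this type). -/
abbrev MetricTensor (N : Type*) [TopologicalSpace N] [ChartedSpace H N] :=
  ∀ q : N, TangentSpace I q →L[ℝ] TangentSpace I q →L[ℝ] ℝ

variable {I}

/-- The coordinate expression of `g` in the preferred chart `φ` at `q`: at the point `y` of the
target of `φ` it is the bilinear form `(v, w) ↦ g (D(φ⁻¹)_y v, D(φ⁻¹)_y w)`, with coefficients
`g_{ij}(y)` in a basis of `E`. -/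
def MetricTensor.inChart (g : MetricTensor I N) (q : N) (y : E) : E →L[ℝ] E →L[ℝ] ℝ :=
  let A : E →L[ℝ] E := mfderiv 𝓘(ℝ, E) I (extChartAt I q).symm y
  let b : E →L[ℝ] E →L[ℝ] ℝ := g ((extChartAt I q).symm y)
  b.bilinearComp A A

/-- The Christoffel symbols of the first kind at `q`, in the preferred chart at `q`:
the linear form `z ↦ (∂_v g(w, z) + ∂_w g(v, z) - ∂_z g(v, w)) / 2`
(for constant coordinate fields `v, w, z`). -/
def MetricTensor.christoffelFirst (g : MetricTensor I N) (q : N) (v w : E) : E →L[ℝ] ℝ :=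
  let D : E →L[ℝ] E →L[ℝ] E →L[ℝ] ℝ := fderiv ℝ (MetricTensor.inChart g q) (extChartAt I q q)
  (1 / 2 : ℝ) • (D v w + D w v - (D.flip v).flip w)

/-- The Christoffel symbols of the Levi-Civita connection of `g` at `q`, in the preferred chart
at `q`: `Γ(v, w)` is obtained from the symbols of the first kind by raising the index with the
inverse of the metric (so, `g` being nondegenerate, `g(Γ(v, w), z)` is the value at `z` of the
symbols of the first kind); i.e. `Γ(∂_i, ∂_j) = ∇_{∂_i} ∂_j` at `q`. -/
def MetricTensor.christoffel (g : MetricTensor I N) (q : N) (v w : E) : E :=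
  (MetricTensor.inChart g q (extChartAt I q q)).inverse (MetricTensor.christoffelFirst g q v w)

end Metric

/-! ### Spacelike immersed submanifolds and their mean curvature vector -/

section Submanifold

variable {E H N : Type*} [NormedAddCommGroup E] [NormedSpace ℝ E] [TopologicalSpace H]
  [TopologicalSpace N] [ChartedSpace H N] {I : ModelWithCorners ℝ E H} (g : MetricTensor I N)
  {k : ℕ} {M : Type*} [TopologicalSpace M] [ChartedSpace (EuclideanSpace ℝ (Fin k)) M]
  (ψ : M → N)

/-- `ψ` is a smooth spacelike immersion into `(N, g)`: the induced bilinear form `ψ^* g` is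
positive definite on every tangent space (in particular every `dψ_p` is injective). -/
def IsSpacelikeImmersion : Prop :=
  ContMDiff (𝓡 k) I ∞ ψ ∧
    ∀ (p : M) (u : TangentSpace (𝓡 k) p), u ≠ 0 →
      0 < g (ψ p) (mfderiv (𝓡 k) I ψ p u) (mfderiv (𝓡 k) I ψ p u)

variable (p : M)

/-- The coordinate vector `∂_i` at `p` of the preferred chart at `p`. -/
def coordVec (i : Fin k) : TangentSpace (𝓡 k) p :=
  (EuclideanSpace.single i (1 : ℝ) : EuclideanSpace ℝ (Fin k))

/-- The matrix `g_{ij} = g(dψ ∂_i, dψ ∂_j)` of the induced metric at `p`. -/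
def inducedGram : Matrix (Fin k) (Fin k) ℝ :=
  Matrix.of fun i j =>
    g (ψ p) (mfderiv (𝓡 k) I ψ p (coordVec p i)) (mfderiv (𝓡 k) I ψ p (coordVec p j))

/-- The component `w^⊥` of `w ∈ T_{ψ(p)} N` normal to `dψ(T_p M)`:
`w - ∑_{i,j} g^{ij} g(w, dψ ∂_i) dψ ∂_j`. -/
def normalPart (w : TangentSpace I (ψ p)) : TangentSpace I (ψ p) :=
  w - ∑ i : Fin k, ∑ j : Fin k,
    ((inducedGram g ψ p)⁻¹ i j * g (ψ p) w (mfderiv (𝓡 k) I ψ p (coordVec p i))) •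
      mfderiv (𝓡 k) I ψ p (coordVec p j)

/-- The ambient covariant derivative `∇̄_u (dψ V)` at `p`, where `V` is the vector field with
constant coefficients `v` in the preferred chart of `M` at `p`:
`D²ψ(u, v) + Γ(dψ u, dψ v)`, computed in the preferred charts at `p` and `ψ p` (with respect to
which the tangent spaces at `p` and `ψ p` are identified with the model spaces). -/
def ambientCovDeriv (u v : TangentSpace (𝓡 k) p) : TangentSpace I (ψ p) :=
  let hess : E := fderiv ℝ (fun x : EuclideanSpace ℝ (Fin k) =>
    fderiv ℝ (writtenInExtChartAt (𝓡 k) I p ψ) x v) (extChartAt (𝓡 k) p p) u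
  let u' : E := mfderiv (𝓡 k) I ψ p u
  let v' : E := mfderiv (𝓡 k) I ψ p v
  (hess + MetricTensor.christoffel g (ψ p) u' v' : E)

/-- The second fundamental form with the sign convention of General Relativity,
`II(u, v) = -(∇̄_u v)^⊥`. -/
def secondFundamentalForm (u v : TangentSpace (𝓡 k) p) : TangentSpace I (ψ p) :=
  -normalPart (k := k) g ψ p (ambientCovDeriv (k := k) g ψ p u v)

/-- The mean curvature vector `H = (1/k) trace II = (1/k) ∑_{i,j} g^{ij} II(∂_i, ∂_j)`. -/
def meanCurvature : TangentSpace I (ψ p) :=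
  (1 / (k : ℝ)) • ∑ i : Fin k, ∑ j : Fin k,
    (inducedGram g ψ p)⁻¹ i j • secondFundamentalForm (k := k) g ψ p (coordVec p i) (coordVec p j)

end Submanifold

/-! ### Generalized Robertson-Walker spacetimes -/

/-- The data of a generalized Robertson-Walker spacetime `I ×_f F` with fiber an `m`-dimensional
manifold `F`: a nonempty open interval `I ⊆ ℝ`, a positive smooth warping function `f` on `I`
(its values outside `I` are irrelevant) and a Riemannian metric `g_F` on `F`.
The spacetime is the open subset `I × F` of the manifold `ℝ × F`. -/
structure GRWSpacetime (m : ℕ) (F : Type*) [TopologicalSpace F]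
    [ChartedSpace (EuclideanSpace ℝ (Fin m)) F] [IsManifold (𝓡 m) ∞ F] where
  /-- the interval of times -/
  I : Set ℝ
  isOpen_I : IsOpen I
  ordConnected_I : I.OrdConnected
  nonempty_I : I.Nonempty
  /-- the warping function -/
  f : ℝ → ℝ
  contDiffOn_f : ContDiffOn ℝ ∞ f I
  f_pos : ∀ t ∈ I, 0 < f t
  /-- the Riemannian metric of the fiber -/
  gF : Bundle.ContMDiffRiemannianMetric (𝓡 m) ∞ (EuclideanSpace ℝ (Fin m))
    (fun x : F => TangentSpace (𝓡 m) x)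

namespace GRWSpacetime

variable {m : ℕ} {F : Type*} [TopologicalSpace F] [ChartedSpace (EuclideanSpace ℝ (Fin m)) F]
  [IsManifold (𝓡 m) ∞ F] (S : GRWSpacetime m F)

/-- The set of events, `I × F ⊆ ℝ × F`. -/
def carrier : Set (ℝ × F) := S.I ×ˢ univ

/-- The Lorentzian metric `-π_I^*(dt²) + f(π_I)² π_F^*(g_F)`. -/
def metric : MetricTensor (𝓘(ℝ, ℝ).prod (𝓡 m)) (ℝ × F) := fun q =>
  let E := EuclideanSpace ℝ (Fin m)
  let dπI : ℝ × E →L[ℝ] ℝ :=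
    mfderiv (𝓘(ℝ, ℝ).prod (𝓡 m)) 𝓘(ℝ, ℝ) (Prod.fst : ℝ × F → ℝ) q
  let dπF : ℝ × E →L[ℝ] E :=
    mfderiv (𝓘(ℝ, ℝ).prod (𝓡 m)) (𝓡 m) (Prod.snd : ℝ × F → F) q
  let h : E →L[ℝ] E →L[ℝ] ℝ := S.gF.inner q.2
  let dtSq : ℝ × E →L[ℝ] ℝ × E →L[ℝ] ℝ := (ContinuousLinearMap.mul ℝ ℝ).bilinearComp dπI dπI
  (-dtSq + S.f q.1 ^ 2 • h.bilinearComp dπF dπF : ℝ × E →L[ℝ] ℝ × E →L[ℝ] ℝ)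

/-- The vector field `∂_t` on `ℝ × F`, which defines the time orientation. -/
def dt (q : ℝ × F) : TangentSpace (𝓘(ℝ, ℝ).prod (𝓡 m)) q :=
  ((1 : ℝ), (0 : EuclideanSpace ℝ (Fin m)))

/-- A tangent vector is causal if it is nonzero and timelike or lightlike. -/
def IsCausal {q : ℝ × F} (v : TangentSpace (𝓘(ℝ, ℝ).prod (𝓡 m)) q) : Prop :=
  v ≠ 0 ∧ S.metric q v v ≤ 0

/-- A (causal) vector is future pointing if it lies in the same half of the causal cone
as `∂_t`. -/
def IsFuturePointing {q : ℝ × F} (v : TangentSpace (𝓘(ℝ, ℝ).prod (𝓡 m)) q) : Prop :=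
  S.metric q v (dt q) < 0

/-- A (causal) vector is past pointing if it lies in the same half of the causal cone
as `-∂_t`. -/
def IsPastPointing {q : ℝ × F} (v : TangentSpace (𝓘(ℝ, ℝ).prod (𝓡 m)) q) : Prop :=
  0 < S.metric q v (dt q)

/-- The comoving observers do not come together: `f' ≥ 0` on `I`. -/
def IsNonContracting : Prop := ∀ t ∈ S.I, 0 ≤ deriv S.f t

/-- The comoving observers do not spread out: `f' ≤ 0` on `I`. -/
def IsNonExpanding : Prop := ∀ t ∈ S.I, deriv S.f t ≤ 0

variable {k : ℕ} {M : Type*} [TopologicalSpace M] [ChartedSpace (EuclideanSpace ℝ (Fin k)) M]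
  (ψ : M → ℝ × F)

/-- `ψ` is an immersed spacelike submanifold of the spacetime `I ×_f F`. -/
def IsSpacelikeSubmanifold : Prop :=
  (∀ p, ψ p ∈ S.carrier) ∧ IsSpacelikeImmersion (k := k) S.metric ψ

/-- `ψ` is weakly future trapped: a spacelike submanifold whose mean curvature vector is
everywhere causal and future pointing. -/
def IsWeaklyFutureTrapped : Prop :=
  S.IsSpacelikeSubmanifold (k := k) ψ ∧
    ∀ p, S.IsCausal (meanCurvature (k := k) S.metric ψ p) ∧ S.IsFuturePointing (meanCurvature (k := k) S.metric ψ p)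

/-- `ψ` is weakly past trapped: a spacelike submanifold whose mean curvature vector is
everywhere causal and past pointing. -/
def IsWeaklyPastTrapped : Prop :=
  S.IsSpacelikeSubmanifold (k := k) ψ ∧
    ∀ p, S.IsCausal (meanCurvature (k := k) S.metric ψ p) ∧ S.IsPastPointing (meanCurvature (k := k) S.metric ψ p)

end GRWSpacetime

end

/-! Let τ be the time coordinate along `ψ`. At a critical point of τ the tangent space of the
submanifold lies in the kernel of `dt`, so passing to the normal part does not change the time
component of a vector. With the sign convention for II this gives `g(H, ∂_t) = (1/k) tr(Hess τ + f
f' g_F)`, where `g_F` is pulled back along the fibre component of `ψ` and the trace is taken with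
the induced metric; the Hessian is the plain coordinate one (`metric_meanCurvature_dt`).

By compactness τ attains its minimum and its maximum. At a minimum `Hess τ ≥ 0`, so `f' ≥ 0` forces
`g(H, ∂_t) ≥ 0` and `H` is not future pointing. At a maximum with `f' ≤ 0` all signs reverse and `H`
is not past pointing.

The geometric input is `metric_christoffel_dt`, which identifies the time component of the
Christoffel symbols. The algebraic input is `EuclideanSpace.sum_mul_nonneg`: the trace of a
nonnegative form against a positive semidefinite matrix is nonnegative. -/

open Filter Topology

/-! ### Second-order conditions at extrema, and bilinear forms -/

section Calculus

variable {k : ℕ}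

/-- A negative second derivative would make the point a local maximum as well, so `f` would be
locally constant and its second derivative zero. -/
theorem IsLocalMin.deriv_deriv_nonneg {f : ℝ → ℝ} {a : ℝ} (h : IsLocalMin f a)
    (hc : ContinuousAt f a) : 0 ≤ deriv (deriv f) a := by
  by_contra! hneg
  have hmax := isLocalMax_of_deriv_deriv_neg hneg h.deriv_eq_zero hc
  have hconst : f =ᶠ[𝓝 a] fun _ => f a := by
    filter_upwards [h, hmax] with x h1 h2 using le_antisymm h2 h1
  have := hconst.deriv.deriv_eq
  simp at this
  linarith

theorem IsLocalMin.fderiv_fderiv_self_nonneg {V : Type*} [NormedAddCommGroup V] [NormedSpace ℝ V]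
    {h : V → ℝ} {x : V} (hx : IsLocalMin h x) (hh : ContDiffAt ℝ 2 h x) (v : V) :
    0 ≤ fderiv ℝ (fderiv ℝ h) x v v := by
  set l : ℝ → V := fun s => x + s • v with hl
  have hl0 : l 0 = x := by simp [hl]
  have hlc : ContinuousAt l 0 := by fun_prop
  have hld : ∀ s, HasDerivAt l v s := fun s => by
    have := ((hasDerivAt_id s).smul_const v).const_add x
    rwa [one_smul] at this
  have hmin : IsLocalMin (h ∘ l) 0 := by
    have : Tendsto l (𝓝 0) (𝓝 x) := by simpa [ContinuousAt, hl0] using hlc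
    have h2 := this.eventually hx
    simpa [IsLocalMin, IsMinFilter, hl0] using h2
  have hev : ∀ᶠ s in 𝓝 (0 : ℝ), DifferentiableAt ℝ h (l s) := by
    have h1 : ∀ᶠ y in 𝓝 x, ContDiffAt ℝ 2 h y := hh.eventually (by simp)
    have : Tendsto l (𝓝 0) (𝓝 x) := by simpa [ContinuousAt, hl0] using hlc
    exact (this.eventually h1).mono fun s hs => hs.differentiableAt two_ne_zero
  have hd1 : deriv (h ∘ l) =ᶠ[𝓝 0] fun s => fderiv ℝ h (l s) v := by
    filter_upwards [hev] with s hs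
    exact (hs.hasFDerivAt.comp_hasDerivAt s (hld s)).deriv
  have hd2 : deriv (fun s => fderiv ℝ h (l s) v) 0 = fderiv ℝ (fderiv ℝ h) x v v := by
    have h1 : DifferentiableAt ℝ (fderiv ℝ h) x :=
      (hh.fderiv_right (m := 1) (by norm_num)).differentiableAt one_ne_zero
    have h2 : HasFDerivAt (fderiv ℝ h) (fderiv ℝ (fderiv ℝ h) x) (l 0) := by
      rw [hl0]; exact h1.hasFDerivAt
    have h3 := h2.comp_hasDerivAt 0 (hld 0)
    simpa using (h3.clm_apply (hasDerivAt_const (0 : ℝ) v)).deriv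
  rw [← hd2, ← hd1.deriv_eq]
  refine hmin.deriv_deriv_nonneg ?_
  exact ContinuousAt.comp (by rw [hl0]; exact hh.continuousAt) hlc

theorem DifferentiableAt.hasDerivAt_clm_line {V W : Type*} [NormedAddCommGroup V]
    [NormedSpace ℝ V] [NormedAddCommGroup W] [NormedSpace ℝ W] {B : V → W} {c : V}
    (hB : DifferentiableAt ℝ B c) (u : V) (L : W →L[ℝ] ℝ) :
    HasDerivAt (fun s : ℝ => L (B (c + s • u))) (L (fderiv ℝ B c u)) 0 := by
  have hl : HasDerivAt (fun s : ℝ => c + s • u) u 0 := by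
    have := ((hasDerivAt_id (0 : ℝ)).smul_const u).const_add c
    rwa [one_smul] at this
  have h0 : HasFDerivAt B (fderiv ℝ B c) (c + (0 : ℝ) • u) := by simpa using hB.hasFDerivAt
  exact L.hasFDerivAt.comp_hasDerivAt 0 (h0.comp_hasDerivAt 0 hl)

/-- Reduces each partial derivative of a metric coefficient to a one-variable derivative along a
coordinate line. -/
theorem DifferentiableAt.hasDerivAt_bilin_line {V : Type*} [NormedAddCommGroup V]
    [NormedSpace ℝ V] {B : V → V →L[ℝ] V →L[ℝ] ℝ} {c : V} (hB : DifferentiableAt ℝ B c)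
    (u x z : V) : HasDerivAt (fun s : ℝ => B (c + s • u) x z) (fderiv ℝ B c u x z) 0 :=
  DifferentiableAt.hasDerivAt_clm_line (W := V →L[ℝ] V →L[ℝ] ℝ) hB u
    ((ContinuousLinearMap.apply ℝ ℝ z).comp (ContinuousLinearMap.apply ℝ (V →L[ℝ] ℝ) x))

theorem DifferentiableAt.clm_comp_snd {V W W' : Type*} [NormedAddCommGroup V] [NormedSpace ℝ V]
    [NormedAddCommGroup W] [NormedSpace ℝ W] [NormedAddCommGroup W'] [NormedSpace ℝ W']
    {G : V → W} {y : V} (hG : DifferentiableAt ℝ G y) (P : W →L[ℝ] W') (t : ℝ) :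
    DifferentiableAt ℝ (fun z : ℝ × V => P (G z.2)) (t, y) :=
  P.differentiableAt.comp _ (hG.comp (f := Prod.snd) (t, y) differentiableAt_snd)

theorem DifferentiableAt.bilinearComp_snd {V : Type*} [NormedAddCommGroup V] [NormedSpace ℝ V]
    {G : V → V →L[ℝ] V →L[ℝ] ℝ} {y : V} (hG : DifferentiableAt ℝ G y) (t : ℝ) :
    DifferentiableAt ℝ (fun z : ℝ × V => (G z.2).bilinearComp (ContinuousLinearMap.snd ℝ ℝ V)
      (ContinuousLinearMap.snd ℝ ℝ V)) (t, y) :=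
  DifferentiableAt.clm_comp_snd (W := V →L[ℝ] V →L[ℝ] ℝ) (W' := ℝ × V →L[ℝ] ℝ × V →L[ℝ] ℝ) hG
    -- Pulling a form back along the projection is continuous and linear in the form; this is that
    -- operator.
    ((ContinuousLinearMap.precomp (ℝ × V →L[ℝ] ℝ) (ContinuousLinearMap.snd ℝ ℝ V)).comp
      (ContinuousLinearMap.postcomp V
        (ContinuousLinearMap.precomp ℝ (ContinuousLinearMap.snd ℝ ℝ V)))) t

theorem DifferentiableAt.const_add_sq_smul {V W : Type*} [NormedAddCommGroup V] [NormedSpace ℝ V]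
    [NormedAddCommGroup W] [NormedSpace ℝ W] {a : V → ℝ} {G : V → W} {y : V}
    (ha : DifferentiableAt ℝ a y) (hG : DifferentiableAt ℝ G y) (w : W) :
    DifferentiableAt ℝ (fun z => w + a z ^ 2 • G z) y :=
  ((ha.pow 2).smul hG).const_add w

theorem EuclideanSpace.apply_apply_eq_sum (Q : EuclideanSpace ℝ (Fin k) →L[ℝ] EuclideanSpace ℝ (Fin k) →L[ℝ] ℝ)
    (x y : EuclideanSpace ℝ (Fin k)) :
    Q x y = ∑ i, ∑ j, x i * y j * Q (EuclideanSpace.single i 1) (EuclideanSpace.single j 1) := by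
  have hsum : ∀ z : EuclideanSpace ℝ (Fin k), z = ∑ i, z i • EuclideanSpace.single i (1 : ℝ) := by
    intro z
    ext j
    simp [Finset.sum_apply, Pi.single_apply]
  conv_lhs => rw [hsum x, hsum y]
  simp only [map_sum, map_smul, sum_apply, smul_apply,
    smul_eq_mul, Finset.mul_sum]
  rw [Finset.sum_comm]
  exact Finset.sum_congr rfl fun i _ => Finset.sum_congr rfl fun j _ => by ring

theorem EuclideanSpace.posDef_gram {b : EuclideanSpace ℝ (Fin k) →L[ℝ] EuclideanSpace ℝ (Fin k) →L[ℝ] ℝ}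
    (hsymm : ∀ u v, b u v = b v u) (hpos : ∀ u, u ≠ 0 → 0 < b u u) :
    (Matrix.of fun i j : Fin k =>
      b (EuclideanSpace.single i 1) (EuclideanSpace.single j 1)).PosDef := by
  refine Matrix.PosDef.of_dotProduct_mulVec_pos ?_ ?_
  · ext i j
    simp [hsymm (EuclideanSpace.single j 1)]
  · intro x hx
    have h := hpos (WithLp.toLp 2 x) (by simpa using hx)
    rw [EuclideanSpace.apply_apply_eq_sum] at h
    refine h.trans_eq (Eq.symm ?_)
    simp only [dotProduct, Matrix.mulVec, Finset.mul_sum, Matrix.of_apply, star_trivial]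
    exact Finset.sum_congr rfl fun i _ => Finset.sum_congr rfl fun j _ => by ring

/-- A positive semidefinite matrix is a sum of rank-one matrices `c cᵀ`, which turns the trace into
a sum of values `Q(c, c)`. -/
theorem EuclideanSpace.sum_mul_nonneg {A : Matrix (Fin k) (Fin k) ℝ} (hA : A.PosSemidef)
    {Q : EuclideanSpace ℝ (Fin k) →L[ℝ] EuclideanSpace ℝ (Fin k) →L[ℝ] ℝ}
    (hQ : ∀ u, 0 ≤ Q u u) :
    0 ≤ ∑ i, ∑ j, A i j * Q (EuclideanSpace.single i 1) (EuclideanSpace.single j 1) := by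
  obtain ⟨r, c, rfl⟩ := Matrix.posSemidef_iff_eq_sum_vecMulVec.1 hA
  have h : 0 ≤ ∑ l, Q (WithLp.toLp 2 (c l)) (WithLp.toLp 2 (c l)) :=
    Finset.sum_nonneg fun l _ => hQ _
  convert h using 1
  simp_rw [EuclideanSpace.apply_apply_eq_sum Q (WithLp.toLp 2 (c _)), Matrix.sum_apply,
    Matrix.vecMulVec_apply, Pi.star_apply, star_trivial, Finset.sum_mul]
  symm
  rw [Finset.sum_comm]
  exact Finset.sum_congr rfl fun x _ => Finset.sum_comm

/-- Nondegeneracy is injectivity into the dual, which has the same dimension. This is needed because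
`inverse` takes the default value zero on noninvertible maps. -/
theorem ContinuousLinearMap.isInvertible_of_separatingLeft {V : Type*} [NormedAddCommGroup V]
    [NormedSpace ℝ V] [FiniteDimensional ℝ V] (B : V →L[ℝ] V →L[ℝ] ℝ)
    (hB : ∀ v, (∀ w, B v w = 0) → v = 0) : B.IsInvertible := by
  have hinj : Function.Injective (B : V →ₗ[ℝ] V →L[ℝ] ℝ) := by
    rw [← LinearMap.ker_eq_bot, LinearMap.ker_eq_bot']
    intro v hv
    exact hB v fun w => congrArg (fun φ : V →L[ℝ] ℝ => φ w) hv
  have hfin : Module.finrank ℝ V = Module.finrank ℝ (V →L[ℝ] ℝ) := by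
    rw [← (LinearMap.toContinuousLinearMap : (V →ₗ[ℝ] ℝ) ≃ₗ[ℝ] _).finrank_eq]
    exact Subspace.dual_finrank_eq.symm
  refine ⟨(LinearEquiv.ofInjectiveOfFinrankEq (B : V →ₗ[ℝ] V →L[ℝ] ℝ) hinj hfin).toContinuousLinearEquiv, ?_⟩
  ext v w
  rfl

end Calculus

/-! ### Metric tensors in the preferred chart -/

section Chart

open Bundle

variable {E H N : Type*} [NormedAddCommGroup E] [NormedSpace ℝ E] [TopologicalSpace H]
  [TopologicalSpace N] [ChartedSpace H N] {I : ModelWithCorners ℝ E H} [I.Boundaryless]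
  [IsManifold I 1 N]

/-- The tangent space at `q` is identified with `E` through this very chart, so the derivative is a
coordinate change from the chart to itself. -/
theorem mfderiv_extChartAt_symm_self (q : N) :
    (mfderiv 𝓘(ℝ, E) I (extChartAt I q).symm (extChartAt I q q) : E →L[ℝ] E) =
      ContinuousLinearMap.id ℝ E := by
  have h := TangentBundle.symmL_trivializationAt (𝕜 := ℝ) (I := I) (mem_chart_source H q)
  rw [I.range_eq_univ, mfderivWithin_univ] at h
  rw [TangentBundle.symmL_trivializationAt_eq_core (mem_chart_source H q)] at h
  refine Eq.trans h.symm ?_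
  ext v
  exact (tangentBundleCore I N).coordChange_self _ _ (mem_chart_source H q) v

theorem MetricTensor.inChart_self (g : MetricTensor I N) (q : N) (v w : E) :
    g.inChart q (extChartAt I q q) v w = g q v w := by
  have h : ∀ (x : N), x = q → ∀ a b : E, g x a b = g q a b := by
    rintro x rfl a b; rfl
  have hA := mfderiv_extChartAt_symm_self (I := I) q
  have hv := congrArg (fun A : E →L[ℝ] E => A v) hA
  have hw := congrArg (fun A : E →L[ℝ] E => A w) hA
  simp only [ContinuousLinearMap.id_apply] at hv hw
  refine (h _ (extChartAt_to_inv q) _ _).trans ?_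
  exact congrArg₂ (fun a b : E => g q a b) hv hw

theorem MetricTensor.apply_christoffel (g : MetricTensor I N) {q : N}
    (h : (g.inChart q (extChartAt I q q)).IsInvertible) (v w z : E) :
    g q (g.christoffel q v w) z =
      (1 / 2 : ℝ) * (fderiv ℝ (g.inChart q) (extChartAt I q q) v w z +
        fderiv ℝ (g.inChart q) (extChartAt I q q) w v z -
        fderiv ℝ (g.inChart q) (extChartAt I q q) z v w) := by
  refine (g.inChart_self q _ z).symm.trans ?_
  exact congrArg (fun φ : E →L[ℝ] ℝ => φ z) (h.self_apply_inverse _)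

/-- Regularity of the metric is stated through bundle trivializations. The inverse trivialization
based at `q` is the derivative of the inverse chart, so `inChart` agrees near the point with the
trivialized metric composed with the inverse chart. -/
theorem Bundle.ContMDiffRiemannianMetric.differentiableAt_inChart {n : ℕ∞ω} (hn : 1 ≤ n)
    (g : ContMDiffRiemannianMetric I n E (fun x : N => TangentSpace I x)) (q : N) :
    DifferentiableAt ℝ (MetricTensor.inChart (I := I) g.inner q) (extChartAt I q q) := by
  have h1 := ((contMDiffAt_hom_bundle _).1 (g.contMDiff q)).2
  have h2 : ContMDiffAt 𝓘(ℝ, E) I 1 (extChartAt I q).symm (extChartAt I q q) :=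
    (contMDiffOn_extChartAt_symm q).contMDiffAt (extChartAt_target_mem_nhds q)
  have h1' := h1.of_le hn
  have h3 := (ContMDiffAt.comp_of_eq (x := extChartAt I q q) h1' h2 (extChartAt_to_inv q))
  have h4 := h3.contDiffAt.differentiableAt one_ne_zero
  refine h4.congr_of_eventuallyEq ?_
  filter_upwards [extChartAt_target_mem_nhds (I := I) q] with y hy
  have hy' : (extChartAt I q).symm y ∈ (chartAt H q).source := by
    rw [← extChartAt_source (I := I)]; exact (extChartAt I q).map_target hy
  have h := TangentBundle.symmL_trivializationAt (𝕜 := ℝ) (I := I) hy'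
  rw [I.range_eq_univ, mfderivWithin_univ, (extChartAt I q).right_inv hy] at h
  ext v w
  simp only [Function.comp_def]
  rw [inCoordinates_apply_eq₂ (by simpa using hy') (by simpa using hy') (Set.mem_univ _)]
  have hs : ∀ u : E, (trivializationAt E (TangentSpace I) q).symm ((extChartAt I q).symm y) u =
      (mfderiv 𝓘(ℝ, E) I (extChartAt I q).symm y : E →L[ℝ] E) u := by
    intro u
    rw [← Trivialization.symmL_apply (R := ℝ) _ (by simpa using hy')]
    exact congrArg (fun A : E →L[ℝ] E => A u) h
  rw [hs, hs]
  simp [MetricTensor.inChart]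
  rfl

end Chart

/-! ### The warped metric in charts and its Christoffel symbols -/

theorem extChartAt_real_prod {m : ℕ} {F : Type*} [TopologicalSpace F]
    [ChartedSpace (EuclideanSpace ℝ (Fin m)) F] (q : ℝ × F) :
    extChartAt (𝓘(ℝ, ℝ).prod (𝓡 m)) q = (PartialEquiv.refl ℝ).prod (extChartAt (𝓡 m) q.2) := by
  rw [extChartAt_prod, extChartAt_model_space_eq_id]

namespace GRWSpacetime
variable {m : ℕ} {F : Type*} [TopologicalSpace F] [ChartedSpace (EuclideanSpace ℝ (Fin m)) F]
  [IsManifold (𝓡 m) ∞ F] (S : GRWSpacetime m F)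

theorem metric_apply (q : ℝ × F) (v w : ℝ × EuclideanSpace ℝ (Fin m)) :
    S.metric q v w = -(v.1 * w.1) +
      S.f q.1 ^ 2 * S.gF.inner q.2 (v.2 : EuclideanSpace ℝ (Fin m)) (w.2 : EuclideanSpace ℝ (Fin m)) := by
  simp only [metric, mfderiv_fst, mfderiv_snd]
  rfl

theorem inChart_metric (q : ℝ × F) {y : ℝ × EuclideanSpace ℝ (Fin m)}
    (hy : y.2 ∈ (extChartAt (𝓡 m) q.2).target) (v w : ℝ × EuclideanSpace ℝ (Fin m)) :
    MetricTensor.inChart S.metric q y v w = -(v.1 * w.1) +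
      S.f y.1 ^ 2 * MetricTensor.inChart (I := 𝓡 m) S.gF.inner q.2 y.2 v.2 w.2 := by
  have : IsManifold (𝓡 m) 1 F := IsManifold.of_le (n := ∞) (by simp)
  have h1 : ∀ u : ℝ × EuclideanSpace ℝ (Fin m),
      (mfderiv 𝓘(ℝ, ℝ × EuclideanSpace ℝ (Fin m)) (𝓘(ℝ, ℝ).prod (𝓡 m))
        (extChartAt (𝓘(ℝ, ℝ).prod (𝓡 m)) q).symm y : _ →L[ℝ] ℝ × EuclideanSpace ℝ (Fin m)) u =
      (u.1, (mfderiv 𝓘(ℝ, EuclideanSpace ℝ (Fin m)) (𝓡 m)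
        (extChartAt (𝓡 m) q.2).symm y.2 : _ →L[ℝ] EuclideanSpace ℝ (Fin m)) u.2) := by
    intro u
    have hF : MDifferentiableAt 𝓘(ℝ, EuclideanSpace ℝ (Fin m)) (𝓡 m)
        (extChartAt (𝓡 m) q.2).symm y.2 := by
      have := mdifferentiableWithinAt_extChartAt_symm hy
      rwa [ModelWithCorners.range_eq_univ, mdifferentiableWithinAt_univ] at this
    have heq : ((extChartAt (𝓘(ℝ, ℝ).prod (𝓡 m)) q).symm : _ → ℝ × F) =
        Prod.map id (extChartAt (𝓡 m) q.2).symm := by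
      rw [extChartAt_real_prod]
      rfl
    -- The model structure on the product vector space is read as a product of models, so that the
    -- derivative splits.
    rw [heq, modelWithCornersSelf_prod, ← chartedSpaceSelf_prod]
    rw [mfderiv_prodMap mdifferentiableAt_id hF]
    rw [mfderiv_id]
    rfl
  have h2 : (extChartAt (𝓘(ℝ, ℝ).prod (𝓡 m)) q).symm y =
      (y.1, (extChartAt (𝓡 m) q.2).symm y.2) := by
    rw [extChartAt_real_prod]
    rfl
  have h3 : ∀ x x' : ℝ × F, x = x' → ∀ a b : ℝ × EuclideanSpace ℝ (Fin m),
      S.metric x a b = S.metric x' a b := by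
    rintro x _ rfl a b; rfl
  refine (h3 _ _ h2 _ _).trans ?_
  refine (congrArg₂ (fun a b => S.metric (y.1, (extChartAt (𝓡 m) q.2).symm y.2) a b)
    (h1 v) (h1 w)).trans ?_
  refine (S.metric_apply _ _ _).trans ?_
  rfl

theorem isInvertible_inChart_metric {q : ℝ × F} (hq : q.1 ∈ S.I) :
    (MetricTensor.inChart S.metric q (extChartAt (𝓘(ℝ, ℝ).prod (𝓡 m)) q q)).IsInvertible := by
  have : IsManifold (𝓡 m) 1 F := IsManifold.of_le (n := ∞) (by simp)
  have : IsManifold (𝓘(ℝ, ℝ).prod (𝓡 m)) 1 (ℝ × F) := inferInstance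
  refine ContinuousLinearMap.isInvertible_of_separatingLeft _ fun v hv => ?_
  -- Pairing `v` with its time reflection gives `v.1² + f² g_F(v.2, v.2)`, a sum of nonnegative
  -- terms.
  have h := hv (-v.1, v.2)
  rw [MetricTensor.inChart_self, metric_apply] at h
  have hf : 0 < S.f q.1 ^ 2 := pow_pos (S.f_pos _ hq) 2
  have h0 : v.2 = 0 := by
    by_contra hne
    have hp := S.gF.pos q.2 v.2 hne
    have := mul_pos hf hp
    simp only at h
    nlinarith [mul_self_nonneg v.1]
  have h1 : v.1 = 0 := by
    have hz : S.gF.inner q.2 v.2 v.2 = 0 := by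
      rw [h0]; exact map_zero (S.gF.inner q.2 (0 : EuclideanSpace ℝ (Fin m)))
    simp only at h
    erw [hz] at h
    simpa using h
  exact Prod.ext h1 h0

theorem differentiableAt_inChart_metric {q : ℝ × F} (hq : q.1 ∈ S.I) :
    DifferentiableAt ℝ (MetricTensor.inChart S.metric q)
      (extChartAt (𝓘(ℝ, ℝ).prod (𝓡 m)) q q) := by
  have : IsManifold (𝓡 m) 1 F := IsManifold.of_le (n := ∞) (by simp)
  have hc : extChartAt (𝓘(ℝ, ℝ).prod (𝓡 m)) q q = (q.1, extChartAt (𝓡 m) q.2 q.2) := by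
    rw [extChartAt_real_prod]; rfl
  rw [hc]
  have hf : DifferentiableAt ℝ S.f q.1 :=
    (S.contDiffOn_f.differentiableOn (by simp)).differentiableAt (S.isOpen_I.mem_nhds hq)
  have hG : DifferentiableAt ℝ (MetricTensor.inChart (I := 𝓡 m) S.gF.inner q.2)
      (extChartAt (𝓡 m) q.2 q.2) := S.gF.differentiableAt_inChart (by simp) q.2
  have hf' : DifferentiableAt ℝ (fun y : ℝ × EuclideanSpace ℝ (Fin m) => S.f y.1)
      (q.1, extChartAt (𝓡 m) q.2 q.2) :=
    DifferentiableAt.comp (g := S.f) _ hf differentiableAt_fst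
  have h : DifferentiableAt ℝ (fun y : ℝ × EuclideanSpace ℝ (Fin m) =>
      -(ContinuousLinearMap.mul ℝ ℝ).bilinearComp
        (ContinuousLinearMap.fst ℝ ℝ (EuclideanSpace ℝ (Fin m)))
        (ContinuousLinearMap.fst ℝ ℝ (EuclideanSpace ℝ (Fin m))) +
      S.f y.1 ^ 2 • (MetricTensor.inChart (I := 𝓡 m) S.gF.inner q.2 y.2).bilinearComp
        (ContinuousLinearMap.snd ℝ ℝ (EuclideanSpace ℝ (Fin m)))
        (ContinuousLinearMap.snd ℝ ℝ (EuclideanSpace ℝ (Fin m))))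
      (q.1, extChartAt (𝓡 m) q.2 q.2) :=
    DifferentiableAt.const_add_sq_smul
      (W := ℝ × EuclideanSpace ℝ (Fin m) →L[ℝ] ℝ × EuclideanSpace ℝ (Fin m) →L[ℝ] ℝ)
      hf' (DifferentiableAt.bilinearComp_snd hG q.1) _
  refine h.congr_of_eventuallyEq ?_
  have hev : ∀ᶠ y : ℝ × EuclideanSpace ℝ (Fin m) in 𝓝 (q.1, extChartAt (𝓡 m) q.2 q.2),
      y.2 ∈ (extChartAt (𝓡 m) q.2).target :=
    continuousAt_snd.eventually (extChartAt_target_mem_nhds (I := 𝓡 m) q.2)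
  filter_upwards [hev] with y hy
  refine ContinuousLinearMap.ext fun v => ContinuousLinearMap.ext fun w => ?_
  rw [S.inChart_metric q hy]
  rfl

/-- In the symbols of the first kind with last argument `∂_t`, two terms differentiate the constant
coefficients `g(·, ∂_t)` and vanish. What remains is minus half the time derivative of `f² g_F(v,
w)`. -/
theorem metric_christoffel_dt {q : ℝ × F} (hq : q.1 ∈ S.I)
    (v w : ℝ × EuclideanSpace ℝ (Fin m)) :
    S.metric q (MetricTensor.christoffel (E := ℝ × EuclideanSpace ℝ (Fin m)) S.metric q v w) (dt q) =
      -(S.f q.1 * deriv S.f q.1 * S.gF.inner q.2 v.2 w.2) := by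
  have : IsManifold (𝓡 m) 1 F := IsManifold.of_le (n := ∞) (by simp)
  have : IsManifold (𝓘(ℝ, ℝ).prod (𝓡 m)) 1 (ℝ × F) := inferInstance
  have hc : extChartAt (𝓘(ℝ, ℝ).prod (𝓡 m)) q q = (q.1, extChartAt (𝓡 m) q.2 q.2) := by
    rw [extChartAt_real_prod]; rfl
  set c : ℝ × EuclideanSpace ℝ (Fin m) := extChartAt (𝓘(ℝ, ℝ).prod (𝓡 m)) q q with hcdef
  set e : ℝ × EuclideanSpace ℝ (Fin m) := (1, 0) with he
  have hdir := DifferentiableAt.hasDerivAt_bilin_line (S.differentiableAt_inChart_metric hq)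
  rw [← hcdef] at hdir
  have hev : ∀ u : ℝ × EuclideanSpace ℝ (Fin m), ∀ᶠ s : ℝ in 𝓝 0,
      (c + s • u).2 ∈ (extChartAt (𝓡 m) q.2).target := by
    intro u
    have hcont : ContinuousAt (fun s : ℝ => (c + s • u).2) 0 := by fun_prop
    refine hcont.eventually ?_
    have : (c + (0 : ℝ) • u).2 = extChartAt (𝓡 m) q.2 q.2 := by simp [hc]
    simp only [this]
    exact extChartAt_target_mem_nhds q.2
  have hzero : ∀ u x : ℝ × EuclideanSpace ℝ (Fin m), fderiv ℝ (MetricTensor.inChart S.metric q) c u x e = 0 := by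
    intro u x
    refine (hdir u x e).unique ((hasDerivAt_const (0 : ℝ) (-x.1)).congr_of_eventuallyEq ?_)
    filter_upwards [hev u] with s hs
    rw [S.inChart_metric q hs]
    simp [he]
  -- Moving along `e = ∂_t` fixes the point of the fibre, so only the factor `f²` varies.
  have htime : fderiv ℝ (MetricTensor.inChart S.metric q) c e v w =
      2 * S.f q.1 * deriv S.f q.1 * S.gF.inner q.2 v.2 w.2 := by
    have hf : HasDerivAt S.f (deriv S.f q.1) (q.1 + 0) := by
      rw [add_zero]
      exact ((S.contDiffOn_f.differentiableOn (by simp)).differentiableAt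
        (S.isOpen_I.mem_nhds hq)).hasDerivAt
    have hf' : HasDerivAt (fun s : ℝ => -(v.1 * w.1) +
        S.f (q.1 + s) ^ 2 * S.gF.inner q.2 v.2 w.2) _ 0 :=
      (((hf.comp_const_add q.1 0).pow 2).mul_const _).const_add _
    refine ((hdir e v w).unique (hf'.congr_of_eventuallyEq ?_)).trans ?_
    · filter_upwards [hev e] with s hs
      rw [S.inChart_metric q hs]
      have h2 : (c + s • e).2 = extChartAt (𝓡 m) q.2 q.2 := by simp [hc, he]
      have h1 : (c + s • e).1 = q.1 + s := by simp [hc, he]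
      rw [h1, h2, MetricTensor.inChart_self]
    · simp
  refine (MetricTensor.apply_christoffel S.metric (S.isInvertible_inChart_metric hq) v w e).trans ?_
  rw [← hcdef]
  rw [hzero, hzero, htime]
  ring

end GRWSpacetime

/-! ### Smooth maps read in charts -/

section Chart

variable {E H N : Type*} [NormedAddCommGroup E] [NormedSpace ℝ E] [TopologicalSpace H]
  [TopologicalSpace N] [ChartedSpace H N] {I : ModelWithCorners ℝ E H}
  {k : ℕ} {M : Type*} [TopologicalSpace M] [ChartedSpace (EuclideanSpace ℝ (Fin k)) M]
  {ψ : M → N} {n : ℕ∞ω}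

theorem ContMDiffAt.contDiffAt_writtenInExtChartAt {p : M} (h : ContMDiffAt (𝓡 k) I n ψ p) :
    ContDiffAt ℝ n (writtenInExtChartAt (𝓡 k) I p ψ) (extChartAt (𝓡 k) p p) := by
  have := (contMDiffAt_iff.1 h).2
  rwa [ModelWithCorners.range_eq_univ, contDiffWithinAt_univ] at this

theorem ContMDiffAt.mfderiv_eq_fderiv_writtenInExtChartAt {p : M}
    (h : ContMDiffAt (𝓡 k) I n ψ p) (hn : n ≠ 0) :
    (mfderiv (𝓡 k) I ψ p : EuclideanSpace ℝ (Fin k) →L[ℝ] E) =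
      fderiv ℝ (writtenInExtChartAt (𝓡 k) I p ψ) (extChartAt (𝓡 k) p p) := by
  refine (h.mdifferentiableAt hn).mfderiv.trans ?_
  rw [ModelWithCorners.range_eq_univ, fderivWithin_univ]

end Chart

/-! ### The time function and the second fundamental form -/

namespace GRWSpacetime

section TimeFunction

variable {k m : ℕ} {M : Type*} [TopologicalSpace M] [ChartedSpace (EuclideanSpace ℝ (Fin k)) M]

/-- The time function along `ψ`, in the preferred chart at `p`. -/
noncomputable def timeInChart {F : Type*} (ψ : M → ℝ × F) (p : M) (x : EuclideanSpace ℝ (Fin k)) : ℝ :=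
  (ψ ((extChartAt (𝓡 k) p).symm x)).1

theorem fst_writtenInExtChartAt {F : Type*} [TopologicalSpace F]
    [ChartedSpace (EuclideanSpace ℝ (Fin m)) F] (ψ : M → ℝ × F) (p : M) (x : EuclideanSpace ℝ (Fin k)) :
    (writtenInExtChartAt (𝓡 k) (𝓘(ℝ, ℝ).prod (𝓡 m)) p ψ x).1 = timeInChart ψ p x := by
  rw [writtenInExtChartAt, extChartAt_real_prod]
  rfl

theorem isLocalMin_timeInChart {F : Type*} {ψ : M → ℝ × F} {p : M} (h : ∀ x, (ψ p).1 ≤ (ψ x).1) :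
    IsLocalMin (timeInChart (k := k) ψ p) (extChartAt (𝓡 k) p p) :=
  Eventually.of_forall fun x => by
    simpa only [timeInChart, extChartAt_to_inv] using h _

theorem isLocalMax_timeInChart {F : Type*} {ψ : M → ℝ × F} {p : M} (h : ∀ x, (ψ x).1 ≤ (ψ p).1) :
    IsLocalMax (timeInChart (k := k) ψ p) (extChartAt (𝓡 k) p p) :=
  Eventually.of_forall fun x => by
    simpa only [timeInChart, extChartAt_to_inv] using h _

variable {F : Type*} [TopologicalSpace F] [ChartedSpace (EuclideanSpace ℝ (Fin m)) F]

/-- The differential of the time function `(t, x) ↦ t`. -/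
noncomputable def timeForm (q : ℝ × F) : TangentSpace (𝓘(ℝ, ℝ).prod (𝓡 m)) q →L[ℝ] ℝ :=
  (ContinuousLinearMap.fst ℝ ℝ (EuclideanSpace ℝ (Fin m)) :
    ℝ × EuclideanSpace ℝ (Fin m) →L[ℝ] ℝ)

variable {ψ : M → ℝ × F} {p : M}

theorem contDiffAt_timeInChart (hψ : ContMDiff (𝓡 k) (𝓘(ℝ, ℝ).prod (𝓡 m)) ∞ ψ) :
    ContDiffAt ℝ ∞ (timeInChart (k := k) ψ p) (extChartAt (𝓡 k) p p) := by
  have h := (hψ p).contDiffAt_writtenInExtChartAt.fst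
  simpa only [fst_writtenInExtChartAt] using h

theorem timeForm_mfderiv (hψ : ContMDiff (𝓡 k) (𝓘(ℝ, ℝ).prod (𝓡 m)) ∞ ψ)
    (u : EuclideanSpace ℝ (Fin k)) :
    timeForm (ψ p) (mfderiv (𝓡 k) (𝓘(ℝ, ℝ).prod (𝓡 m)) ψ p u) =
      fderiv ℝ (timeInChart (k := k) ψ p) (extChartAt (𝓡 k) p p) u := by
  have h1 := (hψ p).mfderiv_eq_fderiv_writtenInExtChartAt (by simp)
  have h2 := ((hψ p).contDiffAt_writtenInExtChartAt.differentiableAt (by simp)).hasFDerivAt.fst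
  simp only [fst_writtenInExtChartAt] at h2
  refine (congrArg (fun A : EuclideanSpace ℝ (Fin k) →L[ℝ] ℝ × EuclideanSpace ℝ (Fin m) =>
    (A u).1) h1).trans ?_
  have h3 : fderiv ℝ (timeInChart (k := k) ψ p) (extChartAt (𝓡 k) p p) = _ := h2.fderiv
  rw [h3]
  rfl

end TimeFunction

variable {m : ℕ} {F : Type*} [TopologicalSpace F] [ChartedSpace (EuclideanSpace ℝ (Fin m)) F]
  [IsManifold (𝓡 m) ∞ F] (S : GRWSpacetime m F)
  {k : ℕ} {M : Type*} [TopologicalSpace M] [ChartedSpace (EuclideanSpace ℝ (Fin k)) M]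

theorem metric_symm (q : ℝ × F) (v w : ℝ × EuclideanSpace ℝ (Fin m)) :
    S.metric q v w = S.metric q w v := by
  rw [metric_apply, metric_apply, mul_comm v.1]
  exact congrArg (fun t => -(w.1 * v.1) + S.f q.1 ^ 2 * t) (S.gF.symm q.2 v.2 w.2)

theorem metric_apply_dt (q : ℝ × F) (v : TangentSpace (𝓘(ℝ, ℝ).prod (𝓡 m)) q) :
    S.metric q v (dt q) = -timeForm q v := by
  refine (S.metric_apply q v (1, 0)).trans ?_
  have h : S.gF.inner q.2 (v : ℝ × EuclideanSpace ℝ (Fin m)).2 (0 : EuclideanSpace ℝ (Fin m)) = 0 :=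
    map_zero (S.gF.inner q.2 (v : ℝ × EuclideanSpace ℝ (Fin m)).2)
  have h' : timeForm q v = (v : ℝ × EuclideanSpace ℝ (Fin m)).1 := rfl
  simp only [h, h']
  ring

variable {ψ : M → ℝ × F} {p : M}

/-- The product chart leaves the time coordinate unchanged, so the time component of `D²ψ` is the
Hessian of τ; the remaining term is the Christoffel contribution. -/
theorem timeForm_ambientCovDeriv (hψ : ContMDiff (𝓡 k) (𝓘(ℝ, ℝ).prod (𝓡 m)) ∞ ψ)
    (hp : (ψ p).1 ∈ S.I) (u v : EuclideanSpace ℝ (Fin k)) :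
    timeForm (ψ p) (ambientCovDeriv (k := k) S.metric ψ p u v) =
      fderiv ℝ (fderiv ℝ (timeInChart (k := k) ψ p)) (extChartAt (𝓡 k) p p) u v +
        S.f (ψ p).1 * deriv S.f (ψ p).1 * S.gF.inner (ψ p).2
          (mfderiv (𝓡 k) (𝓘(ℝ, ℝ).prod (𝓡 m)) ψ p u : ℝ × EuclideanSpace ℝ (Fin m)).2
          (mfderiv (𝓡 k) (𝓘(ℝ, ℝ).prod (𝓡 m)) ψ p v : ℝ × EuclideanSpace ℝ (Fin m)).2 := by
  have hΓ := (S.metric_apply_dt (ψ p) _).symm.trans (S.metric_christoffel_dt hp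
    (mfderiv (𝓡 k) (𝓘(ℝ, ℝ).prod (𝓡 m)) ψ p u : ℝ × EuclideanSpace ℝ (Fin m))
    (mfderiv (𝓡 k) (𝓘(ℝ, ℝ).prod (𝓡 m)) ψ p v : ℝ × EuclideanSpace ℝ (Fin m)))
  rw [neg_inj] at hΓ
  rw [← hΓ]
  have hΦ := (hψ p).contDiffAt_writtenInExtChartAt
  have hev : ∀ᶠ x in 𝓝 (extChartAt (𝓡 k) p p),
      (fderiv ℝ (writtenInExtChartAt (𝓡 k) (𝓘(ℝ, ℝ).prod (𝓡 m)) p ψ) x v).1 =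
        fderiv ℝ (timeInChart (k := k) ψ p) x v := by
    have h1 := (hΦ.of_le (m := 1) (by simp)).eventually (by simp)
    filter_upwards [h1] with x hx
    have h2 := (hx.differentiableAt one_ne_zero).hasFDerivAt.fst
    simp only [fst_writtenInExtChartAt] at h2
    have h3 : fderiv ℝ (timeInChart (k := k) ψ p) x = _ := h2.fderiv
    rw [h3]
    rfl
  have hd : DifferentiableAt ℝ (fun x =>
      fderiv ℝ (writtenInExtChartAt (𝓡 k) (𝓘(ℝ, ℝ).prod (𝓡 m)) p ψ) x v)
      (extChartAt (𝓡 k) p p) :=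
    ((hΦ.fderiv_right (m := 1) (by norm_cast)).differentiableAt one_ne_zero).clm_apply
      (differentiableAt_const v)
  have ht : DifferentiableAt ℝ (fderiv ℝ (timeInChart (k := k) ψ p)) (extChartAt (𝓡 k) p p) :=
    ((contDiffAt_timeInChart hψ).fderiv_right (m := 1) (by norm_cast)).differentiableAt one_ne_zero
  -- Both sides are the derivative of `x ↦ dτ_x(v)`, computed once through `ψ` and once through τ.
  have hhess := (hd.hasFDerivAt.fst.congr_of_eventuallyEq
    (EventuallyEq.symm hev)).unique (ht.hasFDerivAt.clm_apply (hasFDerivAt_const v _))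
  rw [ContinuousLinearMap.comp_zero, zero_add] at hhess
  have hhess' := congrArg (fun A : EuclideanSpace ℝ (Fin k) →L[ℝ] ℝ => A u) hhess
  refine Eq.trans ?_ (congrArg (· + _) hhess')
  rfl

/-- The tangential correction in `normalPart` is a combination of vectors `dψ ∂_j`, all killed by
`dt` at a critical point of τ. -/
theorem timeForm_secondFundamentalForm (hψ : ContMDiff (𝓡 k) (𝓘(ℝ, ℝ).prod (𝓡 m)) ∞ ψ)
    (hcrit : fderiv ℝ (timeInChart (k := k) ψ p) (extChartAt (𝓡 k) p p) = 0)
    (u v : EuclideanSpace ℝ (Fin k)) :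
    timeForm (ψ p) (secondFundamentalForm (k := k) S.metric ψ p u v) =
      -timeForm (ψ p) (ambientCovDeriv (k := k) S.metric ψ p u v) := by
  have hT : ∀ j : Fin k, timeForm (ψ p) (mfderiv (𝓡 k) (𝓘(ℝ, ℝ).prod (𝓡 m)) ψ p (coordVec p j)) = 0 := by
    intro j
    refine (timeForm_mfderiv hψ _).trans ?_
    rw [hcrit]; rfl
  simp only [secondFundamentalForm, normalPart, map_neg, map_sub, map_sum, map_smul, hT]
  simp

/-- At a critical point of the time function `τ` along `ψ`, the scalar product of the mean curvature
vector with `∂_t` is `1/k` times the trace of `Hess τ + f f' g_F`. -/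
theorem metric_meanCurvature_dt (hψ : ContMDiff (𝓡 k) (𝓘(ℝ, ℝ).prod (𝓡 m)) ∞ ψ)
    (hp : (ψ p).1 ∈ S.I)
    (hcrit : fderiv ℝ (timeInChart (k := k) ψ p) (extChartAt (𝓡 k) p p) = 0) :
    ∃ Q : EuclideanSpace ℝ (Fin k) →L[ℝ] EuclideanSpace ℝ (Fin k) →L[ℝ] ℝ,
      (∀ u, ∃ r : ℝ, 0 ≤ r ∧
        Q u u = fderiv ℝ (fderiv ℝ (timeInChart (k := k) ψ p)) (extChartAt (𝓡 k) p p) u u +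
          deriv S.f (ψ p).1 * r) ∧
      S.metric (ψ p) (meanCurvature (k := k) S.metric ψ p) (dt (ψ p)) =
        (1 / (k : ℝ)) * ∑ i, ∑ j, (inducedGram (k := k) S.metric ψ p)⁻¹ i j *
          Q (EuclideanSpace.single i 1) (EuclideanSpace.single j 1) := by
  let A : EuclideanSpace ℝ (Fin k) →L[ℝ] EuclideanSpace ℝ (Fin m) :=
    (ContinuousLinearMap.snd ℝ ℝ (EuclideanSpace ℝ (Fin m))).comp
      (mfderiv (𝓡 k) (𝓘(ℝ, ℝ).prod (𝓡 m)) ψ p :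
        EuclideanSpace ℝ (Fin k) →L[ℝ] ℝ × EuclideanSpace ℝ (Fin m))
  let G : EuclideanSpace ℝ (Fin m) →L[ℝ] EuclideanSpace ℝ (Fin m) →L[ℝ] ℝ := S.gF.inner (ψ p).2
  refine ⟨fderiv ℝ (fderiv ℝ (timeInChart (k := k) ψ p)) (extChartAt (𝓡 k) p p) +
    (S.f (ψ p).1 * deriv S.f (ψ p).1) • G.bilinearComp A A, fun u => ?_, ?_⟩
  -- The positive factor `f` is absorbed into `r`, leaving the sign of the term to `f'`.
  · refine ⟨S.f (ψ p).1 * G (A u) (A u), mul_nonneg (S.f_pos _ hp).le ?_, ?_⟩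
    · by_cases h : A u = 0
      · rw [h]; simp
      · exact (S.gF.pos (ψ p).2 (A u) h).le
    · simp
      ring
  · have hII : ∀ i j : Fin k,
        timeForm (ψ p) (secondFundamentalForm (k := k) S.metric ψ p (coordVec p i) (coordVec p j)) =
        -(fderiv ℝ (fderiv ℝ (timeInChart (k := k) ψ p)) (extChartAt (𝓡 k) p p) +
          (S.f (ψ p).1 * deriv S.f (ψ p).1) • G.bilinearComp A A)
          (EuclideanSpace.single i 1) (EuclideanSpace.single j 1) := by
      intro i j
      refine (S.timeForm_secondFundamentalForm hψ hcrit _ _).trans ?_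
      exact congrArg Neg.neg (S.timeForm_ambientCovDeriv hψ hp _ _)
    refine (S.metric_apply_dt (ψ p) _).trans ?_
    simp only [meanCurvature, map_sum, map_smul, hII, smul_eq_mul]
    simp only [mul_neg, Finset.sum_neg_distrib, neg_neg]

/-! ### Sign of the mean curvature at extrema of time -/

theorem posSemidef_inv_inducedGram (hψ : IsSpacelikeImmersion (k := k) S.metric ψ) (p : M) :
    ((inducedGram (k := k) S.metric ψ p)⁻¹).PosSemidef := by
  let A : EuclideanSpace ℝ (Fin k) →L[ℝ] ℝ × EuclideanSpace ℝ (Fin m) :=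
    mfderiv (𝓡 k) (𝓘(ℝ, ℝ).prod (𝓡 m)) ψ p
  let B : ℝ × EuclideanSpace ℝ (Fin m) →L[ℝ] ℝ × EuclideanSpace ℝ (Fin m) →L[ℝ] ℝ :=
    S.metric (ψ p)
  have h := EuclideanSpace.posDef_gram (b := B.bilinearComp A A)
    (fun u v => S.metric_symm (ψ p) _ _) (fun u hu => hψ.2 p u hu)
  exact h.inv.posSemidef

/-- In a non-contracting spacetime the mean curvature vector is not future pointing at a point
where time is minimal. -/
theorem IsNonContracting.metric_meanCurvature_dt_nonneg (hS : S.IsNonContracting)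
    (hψ : S.IsSpacelikeSubmanifold (k := k) ψ) (hp : ∀ x, (ψ p).1 ≤ (ψ x).1) :
    0 ≤ S.metric (ψ p) (meanCurvature (k := k) S.metric ψ p) (dt (ψ p)) := by
  have hmin := isLocalMin_timeInChart (k := k) hp
  have hI : (ψ p).1 ∈ S.I := (hψ.1 p).1
  obtain ⟨Q, hQ, h⟩ := S.metric_meanCurvature_dt hψ.2.1 hI hmin.fderiv_eq_zero
  rw [h]
  refine mul_nonneg (by positivity)
    (EuclideanSpace.sum_mul_nonneg (S.posSemidef_inv_inducedGram hψ.2 p) fun u => ?_)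
  obtain ⟨r, hr, hu⟩ := hQ u
  rw [hu]
  exact add_nonneg (hmin.fderiv_fderiv_self_nonneg
    ((contDiffAt_timeInChart hψ.2.1).of_le (by norm_cast)) u) (mul_nonneg (hS _ hI) hr)

/-- In a non-expanding spacetime the mean curvature vector is not past pointing at a point
where time is maximal. -/
theorem IsNonExpanding.metric_meanCurvature_dt_nonpos (hS : S.IsNonExpanding)
    (hψ : S.IsSpacelikeSubmanifold (k := k) ψ) (hp : ∀ x, (ψ x).1 ≤ (ψ p).1) :
    S.metric (ψ p) (meanCurvature (k := k) S.metric ψ p) (dt (ψ p)) ≤ 0 := by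
  have hmax := isLocalMax_timeInChart (k := k) hp
  have hI : (ψ p).1 ∈ S.I := (hψ.1 p).1
  obtain ⟨Q, hQ, h⟩ := S.metric_meanCurvature_dt hψ.2.1 hI hmax.fderiv_eq_zero
  rw [h]
  refine mul_nonpos_of_nonneg_of_nonpos (by positivity) ?_
  -- At a maximum it is `-Q` that is nonnegative on the diagonal, by the minimum criterion applied
  -- to `-τ`.
  have hsum := EuclideanSpace.sum_mul_nonneg (S.posSemidef_inv_inducedGram hψ.2 p) (Q := -Q)
    fun u => ?_
  · simpa using hsum
  obtain ⟨r, hr, hu⟩ := hQ u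
  have h2 := hmax.neg.fderiv_fderiv_self_nonneg
    ((contDiffAt_timeInChart hψ.2.1).of_le (by norm_cast)).neg u
  have h3 : fderiv ℝ (fun x => -timeInChart (k := k) ψ p x) =
      fun x => -fderiv ℝ (timeInChart (k := k) ψ p) x := funext fun x => fderiv_fun_neg
  rw [h3, fderiv_fun_neg] at h2
  have h4 := mul_nonpos_of_nonpos_of_nonneg (hS _ hI) hr
  simp only [neg_apply] at h2 ⊢
  rw [hu]
  linarith

end GRWSpacetime

/-! ### Nonexistence of closed weakly trapped submanifolds -/

theorem corollary4p2 {m : ℕ} (hm : 2 ≤ m) {F : Type*} [TopologicalSpace F]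
    [ChartedSpace (EuclideanSpace ℝ (Fin m)) F] [IsManifold (𝓡 m) ∞ F] [ConnectedSpace F]
    (S : GRWSpacetime m F) {k : ℕ} (hk : 1 ≤ k) {M : Type*} [TopologicalSpace M]
    [ChartedSpace (EuclideanSpace ℝ (Fin k)) M] [IsManifold (𝓡 k) ∞ M]
    [ConnectedSpace M] [CompactSpace M] :
    (S.IsNonContracting → ¬ ∃ ψ : M → ℝ × F, S.IsWeaklyFutureTrapped (k := k) ψ) ∧
    (S.IsNonExpanding → ¬ ∃ ψ : M → ℝ × F, S.IsWeaklyPastTrapped (k := k) ψ) := by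
  constructor
  · rintro hS ⟨ψ, hψ, htrap⟩
    have hc : Continuous fun x => (ψ x).1 := continuous_fst.comp hψ.2.1.continuous
    obtain ⟨p, -, hp⟩ := isCompact_univ.exists_isMinOn univ_nonempty hc.continuousOn
    exact (htrap p).2.not_ge
      (GRWSpacetime.IsNonContracting.metric_meanCurvature_dt_nonneg S hS hψ fun x => hp (mem_univ x))
  · rintro hS ⟨ψ, hψ, htrap⟩
    have hc : Continuous fun x => (ψ x).1 := continuous_fst.comp hψ.2.1.continuous
    obtain ⟨p, -, hp⟩ := isCompact_univ.exists_isMaxOn univ_nonempty hc.continuousOn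
    exact (htrap p).2.not_ge
      (GRWSpacetime.IsNonExpanding.metric_meanCurvature_dt_nonpos S hS hψ fun x => hp (mem_univ x))
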